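/- Let $n, m \ge 1$ be integers, and let $G_n^\infty$ be the graph with vertex set $\mathbb{Z}^n$ in which $x$ and $y$ are adjacent if and only if $\|x-y\|_\infty = 1$. For a graph $G$ with vertex set $V$ and an integer $k \ge 1$, a function $f \colon V \to \{1,\dots,k\}$ is an $m$-distance clustered $k$-coloring of $G$ with constant $K$ (a positive integer) if, for every color $i$, every connected component of the subgraph of $G$ induced by $f^{-1}(\{i\})$ has at most $K$ vertices, and any two distinct such components (of the same color $i$) are at distance greater than $m$ in $G$. The $m$-distance clustered chromatic number $\chi_{\star,m}(G)$ is the least $k \ge 1$ such that $G$ has an $m$-distance clustered $k$-coloring with some constant $K$, and $\infty$ if there is no such $k$. If $\chi_{\star,m}(G) < \infty$, then $\widehat{K}_{\star,m}(G)$ denotes the least positive integer $K$ for which $G$ has an $m$-distance clustered $\chi_{\star,m}(G)$-coloring with constant $K$. Then $$\chi_{\star,m}(G_n^\infty) = n+1 \qquad\text{and}\qquad \widehat{K}_{\star,m}(G_n^\infty) \le n!\, m^n .$$ -/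

import Mathlib

/-- The distance in `G` between two sets of vertices: the infimum of the graph distances
between their points (`⊤` if no point of `A` can be joined to a point of `B`). -/
noncomputable def setEDist {V : Type*} (G : SimpleGraph V) (A B : Set V) : ℕ∞ :=
  ⨅ x ∈ A, ⨅ y ∈ B, G.edist x y

/-- The set of vertices of `G` that make up the connected component `C` of the subgraph
induced by `s`. -/
def componentVertices {V : Type*} {G : SimpleGraph V} {s : Set V}
    (C : (G.induce s).ConnectedComponent) : Set V :=
  (fun v : s => (v : V)) '' C.supp

/-- `f` is an `m`-distance clustered `k`-coloring of `G` with the constant `K`: for every color,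
all connected components of the subgraph induced by the color class have at most `K` vertices,
and any two different components are at distance (in `G`) bigger than `m`. -/
def IsClusteredColoringWith {V : Type*} (G : SimpleGraph V) (m k K : ℕ) (f : V → Fin k) : Prop :=
  ∀ i : Fin k,
    (∀ C : (G.induce (f ⁻¹' {i})).ConnectedComponent, (componentVertices C).encard ≤ (K : ℕ∞)) ∧
    (∀ C D : (G.induce (f ⁻¹' {i})).ConnectedComponent, C ≠ D →
      (m : ℕ∞) < setEDist G (componentVertices C) (componentVertices D))

/-- `f` is an `m`-distance clustered `k`-coloring of `G`. -/
def IsClusteredColoring {V : Type*} (G : SimpleGraph V) (m k : ℕ) (f : V → Fin k) : Prop :=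
  ∃ K : ℕ, 0 < K ∧ IsClusteredColoringWith G m k K f

/-- The `m`-distance clustered chromatic number of `G`: the minimum natural number `k ≥ 1` for
which there is an `m`-distance clustered `k`-coloring of `G`, and `⊤` if there is none. -/
noncomputable def clusteredChromaticNumber {V : Type*} (G : SimpleGraph V) (m : ℕ) : ℕ∞ :=
  ⨅ k ∈ {k : ℕ | 1 ≤ k ∧ ∃ f : V → Fin k, IsClusteredColoring G m k f}, (k : ℕ∞)

/-- The optimal cluster size of `G`: the minimum constant `K > 0` that is admissible for some
`m`-distance clustered coloring of `G` whose number of colors is the `m`-distance clustered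
chromatic number of `G`. An infimum over the empty set is `⊤`, so that a finite value is
attained. -/
noncomputable def optimalClusterSize {V : Type*} (G : SimpleGraph V) (m : ℕ) : ℕ∞ :=
  ⨅ K ∈ {K : ℕ | 0 < K ∧ ∃ k : ℕ, (k : ℕ∞) = clusteredChromaticNumber G m ∧
    ∃ f : V → Fin k, IsClusteredColoringWith G m k K f}, (K : ℕ∞)

/-- The king-move graph on `ℤⁿ`: two points are adjacent iff their `ℓ^∞`-distance is `1`.
(The norm of `Fin n → ℤ` is the sup norm.) -/
def kingGraph (n : ℕ) : SimpleGraph (Fin n → ℤ) where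
  Adj x y := ‖x - y‖ = 1
  symm := ⟨fun x y h => by rw [norm_sub_rev]; exact h⟩
  loopless := ⟨fun x h => by simp at h⟩

/-!
Lower bound. In a coloring whose monochromatic components have at most `K` points, label a point `x`
by the least `i` such that the component of `x` reaches `{y | y i ≤ 0}`, and by `n` if there is no
such `i`. On the cube `[0, K]ⁿ` the labels are at most `i` on the face `x i = 0`, and different from
`i` on the face `x i = K`, because a component has extent less than `K`. By Sperner's lemma, `n + 1`
pairwise adjacent or equal points have all the labels `0, …, n`. They lie in different components,
so their colors are different.

Sperner's lemma holds modulo 2. The coboundary of the indicator of the simplices with labels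
`0, …, k - 1` is the indicator of those with labels `0, …, k`. By Stokes' theorem on `[0, N]ᵏ`,
triangulated by prisms over the triangulation of `[0, N]ᵏ⁻¹`, the number of simplices of the second
kind is congruent to the number of simplices of the first kind in the bottom face; the other faces
contribute nothing.

Upper bound. Color `ℤⁿ` by bricks with sides `m, 2m, …, nm`. The bricks of `ℤᵏ⁺¹` above a brick of
`ℤᵏ` form a column of bricks of height `(k + 1)m`, colored cyclically with `k + 2` colors, and the
column is shifted by `-m(k + 2)` times the color, at most `k`, of the brick below. Two bricks of the
same color that are close in the first `k` directions then start at heights that differ by a nonzero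
multiple of `m(k + 2)`, which leaves a gap of `m(k + 2) - m(k + 1) = m` between them.
-/

section Clusters

variable {V α β : Type*} {G : SimpleGraph V}

/-- The vertex set of the monochromatic component of `x`, that is, of the connected component of
`x` in the subgraph of `G` induced by the color class of `x`. -/
def cluster (G : SimpleGraph V) (f : V → α) (x : V) : Set V :=
  componentVertices ((G.induce (f ⁻¹' {f x})).connectedComponentMk ⟨x, rfl⟩)

theorem mem_cluster_self (G : SimpleGraph V) (f : V → α) (x : V) : x ∈ cluster G f x :=
  ⟨⟨x, rfl⟩, rfl, rfl⟩

theorem cluster_eq_of_adj {f : V → α} {x y : V} (hadj : G.Adj x y) (hf : f x = f y) :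
    cluster G f x = cluster G f y := by
  suffices ∀ (i j : α) (hx : x ∈ f ⁻¹' {i}) (hy : y ∈ f ⁻¹' {j}), i = j →
      componentVertices ((G.induce (f ⁻¹' {i})).connectedComponentMk ⟨x, hx⟩) =
        componentVertices ((G.induce (f ⁻¹' {j})).connectedComponentMk ⟨y, hy⟩) from
    this _ _ _ _ hf
  rintro i _ hx hy rfl
  exact congrArg componentVertices <|
    SimpleGraph.ConnectedComponent.sound (SimpleGraph.comap_adj.2 hadj).reachable

theorem exists_walk_length_lt_of_mem_cluster {f : V → α} {x y : V} {K : ℕ}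
    (hK : (cluster G f x).encard ≤ K) (hy : y ∈ cluster G f x) :
    ∃ p : G.Walk x y, p.length < K := by
  classical
  obtain ⟨y, hy, rfl⟩ := hy
  obtain ⟨p, hp⟩ := (SimpleGraph.ConnectedComponent.exact hy.symm).exists_isPath
  let q : G.Walk x y := p.map (SimpleGraph.Embedding.induce _).toHom
  have hq : q.IsPath := hp.map Subtype.val_injective
  have hsupp : q.support = p.support.map Subtype.val := SimpleGraph.Walk.support_map _ _
  have hsub : (q.support.toFinset : Set V) ⊆ cluster G f x := by
    intro z hz
    rw [List.coe_toFinset, Set.mem_ofPred_eq, hsupp] at hz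
    obtain ⟨z, hzp, rfl⟩ := List.mem_map.1 hz
    exact ⟨z, SimpleGraph.ConnectedComponent.sound (p.takeUntil z hzp).reachable.symm, rfl⟩
  have hcard : (q.length + 1 : ℕ∞) ≤ K := by
    have := (Set.encard_le_encard hsub).trans hK
    rwa [Set.encard_coe_eq_coe_finsetCard, List.toFinset_card_of_nodup hq.support_nodup,
      SimpleGraph.Walk.length_support, Nat.cast_add_one] at this
  exact ⟨q, by exact_mod_cast hcard⟩

theorem isClusteredColoringWith_of_partition {m k K : ℕ} (hm : 1 ≤ m) {f : V → Fin k} {B : V → β}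
    (hBf : ∀ x y, B x = B y → f x = f y)
    (hfar : ∀ x y, f x = f y → B x ≠ B y → (m : ℕ∞) < G.edist x y)
    (hconn : ∀ x, (G.induce {y | B y = B x}).Preconnected)
    (hcard : ∀ x, {y | B y = B x}.encard ≤ K) : IsClusteredColoringWith G m k K f := by
  intro i
  have eq_of_reachable {x y : f ⁻¹' {i}} (hxy : (G.induce (f ⁻¹' {i})).Reachable x y) :
      B x = B y := by
    obtain ⟨p⟩ := hxy
    induction p with
    | nil => rfl
    | @cons u v w huv _ ih =>
      refine Eq.trans (by_contra fun hne => ?_) ih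
      refine (hfar u v (u.2.trans v.2.symm) hne).not_ge ?_
      calc G.edist u v = 1 := SimpleGraph.edist_eq_one_iff_adj.2 (SimpleGraph.comap_adj.1 huv)
        _ ≤ m := by exact_mod_cast hm
  have reachable_of_eq {x y : f ⁻¹' {i}} (hxy : B x = B y) :
      (G.induce (f ⁻¹' {i})).Reachable x y := by
    have hsub : {z | B z = B x} ⊆ f ⁻¹' {i} := fun z hz => (hBf z x hz).trans x.2
    exact (hconn x ⟨x, rfl⟩ ⟨y, hxy.symm⟩).map (SimpleGraph.induceHomOfLE _ hsub).toHom
  refine ⟨fun C => ?_, fun C D hCD => ?_⟩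
  · induction C using SimpleGraph.ConnectedComponent.ind with | _ x
    refine (Set.encard_le_encard ?_).trans (hcard x)
    rintro _ ⟨y, hy, rfl⟩
    exact eq_of_reachable (SimpleGraph.ConnectedComponent.exact hy)
  · rw [← ENat.add_one_le_iff (ENat.natCast_ne_top m)]
    refine le_iInf₂ fun x hx => le_iInf₂ fun y hy => ?_
    obtain ⟨x, rfl, rfl⟩ := hx
    obtain ⟨y, rfl, rfl⟩ := hy
    rw [ENat.add_one_le_iff (ENat.natCast_ne_top m)]
    exact hfar x y (x.2.trans y.2.symm) fun hxy =>
      hCD (SimpleGraph.ConnectedComponent.sound (reachable_of_eq hxy))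

end Clusters

section KingGraph

variable {n : ℕ}

theorem kingGraph_adj_iff {x y : Fin n → ℤ} :
    (kingGraph n).Adj x y ↔ x ≠ y ∧ ∀ i, |x i - y i| ≤ 1 := by
  have norm_le_one_iff : ‖x - y‖ ≤ 1 ↔ ∀ i, |x i - y i| ≤ 1 := by
    rw [pi_norm_le_iff_of_nonneg zero_le_one]
    refine forall_congr' fun i => ?_
    rw [Pi.sub_apply, Int.norm_eq_abs]
    exact_mod_cast Iff.rfl
  change ‖x - y‖ = 1 ↔ _
  refine ⟨fun h => ⟨fun hxy => by simp [hxy] at h, norm_le_one_iff.1 h.le⟩, fun ⟨hne, h⟩ =>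
    (norm_le_one_iff.2 h).antisymm ?_⟩
  obtain ⟨i, hi⟩ := Function.ne_iff.1 hne
  refine le_trans ?_ (norm_le_pi_norm (x - y) i)
  rw [Pi.sub_apply, Int.norm_eq_abs]
  exact_mod_cast Int.one_le_abs (sub_ne_zero.2 hi)

theorem abs_sub_le_length_of_kingGraph_walk {x y : Fin n → ℤ} (p : (kingGraph n).Walk x y)
    (i : Fin n) : |x i - y i| ≤ p.length := by
  induction p with
  | nil => simp
  | @cons u v w huv p ih =>
    calc |u i - w i| ≤ |u i - v i| + |v i - w i| := abs_sub_le _ _ _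
      _ ≤ 1 + p.length := add_le_add ((kingGraph_adj_iff.1 huv).2 i) ih
      _ = (SimpleGraph.Walk.cons huv p).length := by
        rw [SimpleGraph.Walk.length_cons, Nat.cast_add_one, add_comm]

theorem lt_edist_kingGraph {m : ℕ} {x y : Fin n → ℤ} {i : Fin n} (h : (m : ℤ) < |x i - y i|) :
    (m : ℕ∞) < (kingGraph n).edist x y := by
  rw [← ENat.add_one_le_iff (ENat.natCast_ne_top m)]
  refine le_iInf fun p => ?_
  exact_mod_cast h.trans_le (abs_sub_le_length_of_kingGraph_walk p i)

theorem kingGraph_induce_Icc_preconnected (a b : Fin n → ℤ) :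
    ((kingGraph n).induce (Set.Icc a b)).Preconnected := by
  rintro ⟨x, hx⟩ ⟨y, hy⟩
  obtain ⟨N, hN⟩ : ∃ N : ℕ, ∀ i, |x i - y i| ≤ N := by
    refine ⟨∑ i, (x i - y i).natAbs, fun i => ?_⟩
    rw [Int.abs_eq_natAbs]
    exact_mod_cast Finset.single_le_sum_of_canonicallyOrdered (f := fun i => (x i - y i).natAbs)
      (Finset.mem_univ i)
  induction N generalizing x with
  | zero =>
    obtain rfl : x = y := funext fun i => sub_eq_zero.1 (abs_nonpos_iff.1 (hN i))
    exact .refl _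
  | succ N ih =>
    let z : Fin n → ℤ := fun i => max (x i - 1) (min (x i + 1) (y i))
    have hz_mem : z ∈ Set.Icc a b := by
      have between (i) : min (x i) (y i) ≤ z i ∧ z i ≤ max (x i) (y i) := by lia
      exact ⟨fun i => (le_min (hx.1 i) (hy.1 i)).trans (between i).1,
        fun i => (between i).2.trans (max_le (hx.2 i) (hy.2 i))⟩
    have hxz_step (i) : |x i - z i| ≤ 1 := by rw [abs_le]; lia
    have hzy_dist (i) : |z i - y i| ≤ N := by
      have := hN i
      rw [abs_le] at this ⊢
      lia
    have hxz : ((kingGraph n).induce (Set.Icc a b)).Reachable ⟨x, hx⟩ ⟨z, hz_mem⟩ := by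
      by_cases hne : x = z
      · simp only [← hne, SimpleGraph.Reachable.refl]
      · exact (SimpleGraph.comap_adj.2 (kingGraph_adj_iff.2 ⟨hne, hxz_step⟩)).reachable
    exact hxz.trans (ih z hz_mem hzy_dist)

end KingGraph

section Bricks

/-- The color, in `{0, …, k}`, of the brick containing the point `(x 0, …, x (k - 1))`, in the
brick coloring of `ℤᵏ`. The bricks of `ℤᵏ⁺¹` lying above a brick of `ℤᵏ` of color `c` have height
`(k + 1) * m`, are shifted by `-m * (k + 2) * c`, and are colored cyclically with `k + 2` colors. -/
def brickColor (m : ℤ) (x : ℕ → ℤ) : ℕ → ℤ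
  | 0 => 0
  | k + 1 => (x k + m * (k + 2) * brickColor m x k) / ((k + 1) * m) % (k + 2)

/-- The position of a point in direction `k` in the brick coloring, counted in bricks: two points
of `ℤⁿ` lie in the same brick iff they have the same levels in all directions. -/
def brickLevel (m : ℤ) (x : ℕ → ℤ) (k : ℕ) : ℤ :=
  (x k + m * (k + 2) * brickColor m x k) / ((k + 1) * m)

variable {m : ℤ} {x y : ℕ → ℤ} {n : ℕ}

theorem brickColor_nonneg (m : ℤ) (x : ℕ → ℤ) (n : ℕ) : 0 ≤ brickColor m x n := by
  cases n with
  | zero => exact le_rfl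
  | succ n => exact Int.emod_nonneg _ (by lia)

theorem brickColor_lt (m : ℤ) (x : ℕ → ℤ) (n : ℕ) : brickColor m x n < n + 1 := by
  cases n with
  | zero => exact zero_lt_one
  | succ n =>
    rw [Nat.cast_add_one, add_assoc, one_add_one_eq_two]
    exact Int.emod_lt_of_pos _ (by lia)

theorem brickColor_congr (h : ∀ k < n, brickLevel m x k = brickLevel m y k) :
    brickColor m x n = brickColor m y n := by
  cases n with
  | zero => rfl
  | succ n => exact congrArg (· % ((n : ℤ) + 2)) (h n n.lt_succ_self)

theorem lt_abs_sub_of_ediv_emod_eq {m n c d s t : ℤ} (hm : 0 < m) (hc : 0 ≤ c) (hcn : c < n)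
    (hd : 0 ≤ d) (hdn : d < n)
    (h : (s + m * (n + 1) * c) / (n * m) % (n + 1) = (t + m * (n + 1) * d) / (n * m) % (n + 1))
    (hne : c = d → (s + m * (n + 1) * c) / (n * m) ≠ (t + m * (n + 1) * d) / (n * m)) :
    m < |s - t| := by
  have hn : 0 < n := hc.trans_lt hcn
  have hw : 0 < n * m := mul_pos hn hm
  have hs := Int.mul_ediv_add_emod (s + m * (n + 1) * c) (n * m)
  have ht := Int.mul_ediv_add_emod (t + m * (n + 1) * d) (n * m)
  have hs_nonneg := Int.emod_nonneg (s + m * (n + 1) * c) hw.ne'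
  have ht_nonneg := Int.emod_nonneg (t + m * (n + 1) * d) hw.ne'
  have hs_lt := Int.emod_lt_of_pos (s + m * (n + 1) * c) hw
  have ht_lt := Int.emod_lt_of_pos (t + m * (n + 1) * d) hw
  generalize (s + m * (n + 1) * c) / (n * m) = p at *
  generalize (t + m * (n + 1) * d) / (n * m) = q at *
  generalize (s + m * (n + 1) * c) % (n * m) = e at *
  generalize (t + m * (n + 1) * d) % (n * m) = e' at *
  obtain ⟨z, hz⟩ := Int.ModEq.dvd h
  obtain rfl : q = p + (n + 1) * z := by linarith
  -- `s - t` is within `n * m - 1` of a nonzero multiple of `m * (n + 1)`.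
  have hst : s - t = m * (n + 1) * (d - c - n * z) + (e - e') := by linear_combination ht - hs
  have hne_zero : d - c - n * z ≠ 0 := by
    intro h0
    have hdc : d - c = 0 :=
      Int.eq_zero_of_abs_lt_dvd ⟨z, sub_eq_zero.1 h0⟩ (by rw [abs_lt]; constructor <;> linarith)
    obtain rfl : z = 0 := by simpa [hdc, hn.ne'] using h0
    exact hne (sub_eq_zero.1 hdc).symm (by ring)
  have hmul : m * (n + 1) ≤ |m * (n + 1) * (d - c - n * z)| := by
    rw [abs_mul, abs_of_pos (by positivity)]
    exact le_mul_of_one_le_right (by positivity) (Int.one_le_abs hne_zero)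
  have hee' : |e - e'| < n * m := by rw [abs_lt]; constructor <;> linarith
  rw [hst, ← sub_neg_eq_add]
  have := abs_sub_abs_le_abs_sub (m * (n + 1) * (d - c - n * z)) (-(e - e'))
  rw [abs_neg] at this
  linarith

theorem exists_lt_abs_sub_of_brickColor_eq (hm : 0 < m) (hxy : brickColor m x n = brickColor m y n)
    (hne : ∃ k < n, brickLevel m x k ≠ brickLevel m y k) : ∃ k < n, m < |x k - y k| := by
  induction n with
  | zero => simp at hne
  | succ n ih =>
    by_cases h : brickColor m x n = brickColor m y n ∧ ∃ k < n, brickLevel m x k ≠ brickLevel m y k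
    · obtain ⟨k, hk, hlt⟩ := ih h.1 h.2
      exact ⟨k, hk.trans n.lt_succ_self, hlt⟩
    · refine ⟨n, n.lt_succ_self, ?_⟩
      have hcast : (n : ℤ) + 1 + 1 = n + 2 := by ring
      refine lt_abs_sub_of_ediv_emod_eq (n := n + 1) hm (brickColor_nonneg m x n)
        (brickColor_lt m x n) (brickColor_nonneg m y n) (brickColor_lt m y n) (hcast ▸ hxy) ?_
      rw [hcast]
      intro hcolor hlevel
      obtain ⟨k, hk, hne⟩ := hne
      obtain hk | rfl := Nat.lt_succ_iff_lt_or_eq.1 hk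
      · exact h ⟨hcolor, k, hk, hne⟩
      · exact hne hlevel

/-- The smallest `k`-th coordinate of a point of the brick containing `x`. -/
def brickCorner (m : ℤ) (x : ℕ → ℤ) (k : ℕ) : ℤ :=
  (k + 1) * m * brickLevel m x k - m * (k + 2) * brickColor m x k

theorem forall_brickLevel_eq_iff (hm : 0 < m) :
    (∀ k < n, brickLevel m y k = brickLevel m x k) ↔
      ∀ k < n, y k ∈ Set.Ico (brickCorner m x k) (brickCorner m x k + (k + 1) * m) := by
  induction n with
  | zero => simp
  | succ n ih =>
    simp only [Nat.forall_lt_succ_right, ← ih]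
    refine and_congr_right fun h => ?_
    have hw : 0 < ((n : ℤ) + 1) * m := by positivity
    rw [brickLevel, Int.ediv_eq_iff_of_pos hw, brickColor_congr h, brickCorner, Set.mem_Ico]
    constructor <;> rintro ⟨h₁, h₂⟩ <;> constructor <;> linarith

theorem encard_Icc_add_sub_one {ι : Type*} [Fintype ι] (a : ι → ℤ) (s : ι → ℕ) :
    (Set.Icc a (fun i => a i + s i - 1)).encard = (∏ i, s i : ℕ) := by
  classical
  have hside (i : ι) : (a i + s i - 1 + 1 - a i).toNat = s i := by lia
  rw [← Finset.coe_Icc, Set.encard_coe_eq_coe_finsetCard, Pi.card_Icc]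
  simp only [Int.card_Icc, hside]

theorem exists_isClusteredColoringWith_kingGraph (n : ℕ) {m : ℕ} (hm : 1 ≤ m) :
    ∃ f, IsClusteredColoringWith (kingGraph n) m (n + 1) (n.factorial * m ^ n) f := by
  let extend (x : Fin n → ℤ) : ℕ → ℤ := Function.extend Fin.val x 0
  have extend_apply (x : Fin n → ℤ) (i : Fin n) : extend x i = x i :=
    Fin.val_injective.extend_apply x 0 i
  let f (x : Fin n → ℤ) : Fin (n + 1) :=
    ⟨(brickColor m (extend x) n).toNat, by have := brickColor_lt m (extend x) n; lia⟩
  let B (x : Fin n → ℤ) (i : Fin n) : ℤ := brickLevel m (extend x) i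
  have hm_pos : (0 : ℤ) < m := by exact_mod_cast hm
  have hf {x y} : f x = f y ↔ brickColor m (extend x) n = brickColor m (extend y) n := by
    have := brickColor_nonneg m (extend x) n
    have := brickColor_nonneg m (extend y) n
    rw [Fin.ext_iff]
    change Int.toNat _ = Int.toNat _ ↔ _
    lia
  have hB {x y} : B x = B y ↔ ∀ k < n, brickLevel m (extend x) k = brickLevel m (extend y) k :=
    funext_iff.trans Fin.forall_iff
  have hfiber (x) : {y | B y = B x} = Set.Icc (fun i : Fin n => brickCorner m (extend x) i)
      (fun i => brickCorner m (extend x) i + ((i + 1) * m : ℕ) - 1) := by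
    ext y
    simp only [Nat.cast_mul, Nat.cast_add_one, Set.mem_ofPred_eq, hB,
      forall_brickLevel_eq_iff hm_pos, Set.mem_Icc, Pi.le_def, ← forall_and, Set.mem_Ico,
      Int.le_sub_one_iff, Fin.forall_iff, ← extend_apply y]
  refine ⟨f, isClusteredColoringWith_of_partition hm (B := B)
    (fun x y h => hf.2 (brickColor_congr (hB.1 h))) (fun x y hcolor hne => ?_) (fun x => ?_)
    fun x => ?_⟩
  · rw [Ne, hB] at hne
    push Not at hne
    obtain ⟨k, hk, hlt⟩ := exists_lt_abs_sub_of_brickColor_eq hm_pos (hf.1 hcolor) hne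
    refine lt_edist_kingGraph (i := ⟨k, hk⟩) ?_
    simpa only [extend_apply _ ⟨k, hk⟩] using hlt
  · rw [hfiber]
    exact kingGraph_induce_Icc_preconnected _ _
  · rw [hfiber, encard_Icc_add_sub_one, Finset.prod_mul_distrib,
      Fin.prod_univ_eq_prod_range (· + 1) n, Finset.prod_range_add_one_eq_factorial,
      Finset.prod_const, Finset.card_univ, Fintype.card_fin]

end Bricks

section Simplices

variable {V W : Type*}

theorem sum_map_flatMap {M : Type*} [AddMonoid M] (f : W → M) (g : V → List W) (l : List V) :
    ((l.flatMap g).map f).sum = (l.map fun v => ((g v).map f).sum).sum := by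
  rw [List.map_flatMap, List.flatMap_def, List.sum_flatten, List.map_map, Function.comp_def]

/-- The facets of an ordered simplex, which is given by the list of its vertices. -/
def facets : List V → List (List V)
  | [] => []
  | v :: l => l :: (facets l).map (List.cons v)

/-- The coboundary of a mod-2 cochain `ω`, that is, of a function of ordered simplices with values
in `ZMod 2`. -/
def coboundary (ω : List V → ZMod 2) (l : List V) : ZMod 2 :=
  ((facets l).map ω).sum

theorem coboundary_cons (ω : List V → ZMod 2) (v : V) (l : List V) :
    coboundary ω (v :: l) = ω l + coboundary (fun q => ω (v :: q)) l := by
  simp only [coboundary, facets, List.map_cons, List.sum_cons, List.map_map, Function.comp_def]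

theorem coboundary_add (ω η : List V → ZMod 2) (l : List V) :
    coboundary (fun q => ω q + η q) l = coboundary ω l + coboundary η l :=
  List.sum_map_add

theorem coboundary_map (ω : List W → ZMod 2) (f : V → W) (l : List V) :
    coboundary ω (l.map f) = coboundary (fun q => ω (q.map f)) l := by
  induction l generalizing ω with
  | nil => rfl
  | cons v l ih => simp only [List.map_cons, coboundary_cons, ih]

theorem coboundary_comp_coe [DecidableEq V] (ω : Multiset V → ZMod 2) (l : List V) :
    coboundary (fun q => ω q) l =
      ((l : Multiset V).map fun a => ω ((l : Multiset V).erase a)).sum := by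
  induction l generalizing ω with
  | nil => rfl
  | cons v l ih =>
    simp only [coboundary_cons, ← Multiset.cons_coe, ih fun s => ω (v ::ₘ s), Multiset.map_cons,
      Multiset.sum_cons, Multiset.erase_cons_head]
    congr 2
    exact Multiset.map_congr rfl fun a ha => by rw [Multiset.erase_cons_tail_of_mem ha]

/-- The simplices triangulating the prism over the simplex `l`, whose bottom and top facets are the
images of `l` under `g` and `h`. -/
def prismSimplices (g h : V → W) : List V → List (List W)
  | [] => []
  | v :: l => (g v :: h v :: l.map h) :: (prismSimplices g h l).map (List.cons (g v))

theorem sum_map_prismSimplices_cons (ω : List W → ZMod 2) (g h : V → W) (v : V) (l : List V) :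
    ((prismSimplices g h (v :: l)).map ω).sum = ω (g v :: h v :: l.map h) +
      ((prismSimplices g h l).map fun q => ω (g v :: q)).sum := by
  simp only [prismSimplices, List.map_cons, List.sum_cons, List.map_map, Function.comp_def]

theorem sum_prismSimplices_coboundary (ω : List W → ZMod 2) (g h : V → W) (l : List V) :
    ((prismSimplices g h l).map (coboundary ω)).sum = ω (l.map g) + ω (l.map h) +
      coboundary (fun q => ((prismSimplices g h q).map ω).sum) l := by
  induction l generalizing ω with
  | nil => exact (CharTwo.add_self_eq_zero (ω [])).symm ▸ rfl
  | cons v l ih =>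
    simp only [sum_map_prismSimplices_cons, coboundary_cons, coboundary_add, List.sum_map_add,
      List.map_cons, ih fun q => ω (g v :: q), coboundary_map]
    linear_combination CharTwo.add_self_eq_zero (ω (g v :: l.map h))

theorem exists_eq_or_eq_of_mem_prismSimplices {g h : V → W} {l : List V} {s : List W}
    (hs : s ∈ prismSimplices g h l) {w : W} (hw : w ∈ s) : ∃ v ∈ l, w = g v ∨ w = h v := by
  induction l generalizing s with
  | nil => simp [prismSimplices] at hs
  | cons v l ih =>
    simp only [prismSimplices, List.mem_cons, List.mem_map] at hs
    obtain rfl | ⟨s, hs, rfl⟩ := hs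
    · simp only [List.mem_cons, List.mem_map] at hw
      grind
    · obtain rfl | hw := List.mem_cons.1 hw
      · exact ⟨v, List.mem_cons_self, .inl rfl⟩
      · obtain ⟨u, hu, huw⟩ := ih hs hw
        exact ⟨u, List.mem_cons_of_mem v hu, huw⟩

theorem pairwise_of_mem_prismSimplices {R : V → V → Prop} {S : W → W → Prop} {g h : V → W}
    (hg : ∀ v w, R v w → S (g v) (g w)) (hh : ∀ v w, R v w → S (h v) (h w))
    (hgh : ∀ v w, R v w → S (g v) (h w)) (hself : ∀ v, S (g v) (h v)) {l : List V}
    (hl : l.Pairwise R) {s : List W} (hs : s ∈ prismSimplices g h l) : s.Pairwise S := by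
  induction l generalizing s with
  | nil => simp [prismSimplices] at hs
  | cons v l ih =>
    obtain ⟨hv, hl⟩ := List.pairwise_cons.1 hl
    simp only [prismSimplices, List.mem_cons, List.mem_map] at hs
    obtain rfl | ⟨s, hs, rfl⟩ := hs
    · have hmap : (l.map h).Pairwise S := List.pairwise_map.2 (hl.imp fun {a b} => hh a b)
      simp only [List.pairwise_cons, List.mem_cons, List.mem_map]
      grind
    · refine List.pairwise_cons.2 ⟨fun w hw => ?_, ih hl hs⟩
      obtain ⟨u, hu, rfl | rfl⟩ := exists_eq_or_eq_of_mem_prismSimplices hs hw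
      exacts [hg v u (hv u hu), hgh v u (hv u hu)]

end Simplices

section Box

/-- The simplices triangulating the cube `[0, N]ᵏ`, whose points are extended by zero to all
coordinates: the triangulation of `[0, N]ᵏ⁺¹` consists of the prisms between the horizontal layers
at heights `t` and `t + 1` of the triangulation of `[0, N]ᵏ`. -/
def boxSimplices (N : ℕ) : ℕ → List (List (ℕ → ℤ))
  | 0 => [[0]]
  | k + 1 => (List.range N).flatMap fun t : ℕ => (boxSimplices N k).flatMap <|
      prismSimplices (Function.update · k (t : ℤ)) (Function.update · k (t + 1 : ℤ))

variable {N k : ℕ} {l : List (ℕ → ℤ)}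

theorem mem_boxSimplices_succ : l ∈ boxSimplices N (k + 1) ↔ ∃ t < N, ∃ q ∈ boxSimplices N k,
    l ∈ prismSimplices (Function.update · k (t : ℤ)) (Function.update · k (t + 1 : ℤ)) q := by
  simp only [boxSimplices, List.mem_flatMap, List.mem_range]

theorem apply_eq_zero_of_mem_boxSimplices (hl : l ∈ boxSimplices N k) {v : ℕ → ℤ} (hv : v ∈ l)
    {i : ℕ} (hi : k ≤ i) : v i = 0 := by
  induction k generalizing l v with
  | zero =>
    obtain rfl := List.mem_singleton.1 hl
    obtain rfl := List.mem_singleton.1 hv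
    rfl
  | succ k ih =>
    obtain ⟨t, -, q, hq, hl⟩ := mem_boxSimplices_succ.1 hl
    obtain ⟨u, hu, rfl | rfl⟩ := exists_eq_or_eq_of_mem_prismSimplices hl hv
    all_goals
      rw [Function.update_of_ne (by lia)]
      exact ih hq hu (by lia)

theorem pairwise_of_mem_boxSimplices (hl : l ∈ boxSimplices N k) :
    l.Pairwise fun v w => ∀ i, v i ≤ w i ∧ w i ≤ v i + 1 := by
  induction k generalizing l with
  | zero =>
    obtain rfl := List.mem_singleton.1 hl
    exact List.pairwise_singleton _ _
  | succ k ih =>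
    obtain ⟨t, -, q, hq, hl⟩ := mem_boxSimplices_succ.1 hl
    refine pairwise_of_mem_prismSimplices ?_ ?_ ?_ ?_ (ih hq) hl
    all_goals
      intros
      simp only [Function.update_apply]
      grind

theorem map_update_zero_of_mem_boxSimplices (hl : l ∈ boxSimplices N k) :
    l.map (Function.update · k 0) = l := by
  refine (List.map_congr_left fun v hv => ?_).trans l.map_id
  rw [← apply_eq_zero_of_mem_boxSimplices hl hv le_rfl, Function.update_eq_self, id]

theorem sum_boxSimplices_succ_coboundary (N k : ℕ) (ω : List (ℕ → ℤ) → ZMod 2) :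
    ((boxSimplices N (k + 1)).map (coboundary ω)).sum =
      ((boxSimplices N k).map ω).sum +
      ((boxSimplices N k).map fun l => ω (l.map (Function.update · k (N : ℤ)))).sum +
      ((List.range N).map fun t : ℕ => ((boxSimplices N k).map <| coboundary fun q =>
        ((prismSimplices (Function.update · k (t : ℤ)) (Function.update · k (t + 1 : ℤ)) q).map
          ω).sum).sum).sum := by
  let layer (t : ℕ) : ZMod 2 :=
    ((boxSimplices N k).map fun l => ω (l.map (Function.update · k (t : ℤ)))).sum
  have hlayer_zero : layer 0 = ((boxSimplices N k).map ω).sum :=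
    congrArg List.sum <| List.map_congr_left fun l hl =>
      congrArg ω (map_update_zero_of_mem_boxSimplices hl)
  have htelescope : ((List.range N).map fun t => layer t + layer (t + 1)).sum =
      layer 0 + layer N := by
    simpa only [CharTwo.sub_eq_add, add_comm] using List.sum_range_sub N layer
  rw [← hlayer_zero, ← htelescope, ← List.sum_map_add]
  simp only [boxSimplices, sum_map_flatMap, sum_prismSimplices_coboundary, List.sum_map_add, layer,
    Nat.cast_add_one]

/-- A cochain that vanishes on the empty simplex and on all simplices lying in one of the
hyperplanes `v i = 0` and `v i = N` for `i < k`: a cochain of the cube `[0, N]ᵏ` relative to its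
boundary. -/
def IsRelativeCochain (N k : ℕ) (ω : List (ℕ → ℤ) → ZMod 2) : Prop :=
  ω [] = 0 ∧ ∀ i < k, ∀ l : List (ℕ → ℤ), (∀ v ∈ l, v i = 0) ∨ (∀ v ∈ l, v i = N) → ω l = 0

namespace IsRelativeCochain

variable {ω : List (ℕ → ℤ) → ZMod 2}

theorem of_succ (hω : IsRelativeCochain N (k + 1) ω) : IsRelativeCochain N k ω :=
  ⟨hω.1, fun i hi => hω.2 i (hi.trans k.lt_succ_self)⟩

theorem sum_prismSimplices_update (hω : IsRelativeCochain N k ω) (a b : ℤ) :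
    IsRelativeCochain N k fun l =>
      ((prismSimplices (Function.update · k a) (Function.update · k b) l).map ω).sum := by
  refine ⟨rfl, fun i hi l hl => List.sum_eq_zero <| List.forall_mem_map.2 fun s hs =>
    hω.2 i hi s ?_⟩
  have wall {c : ℤ} (h : ∀ v ∈ l, v i = c) : ∀ w ∈ s, w i = c := by
    intro w hw
    obtain ⟨v, hv, rfl | rfl⟩ := exists_eq_or_eq_of_mem_prismSimplices hs hw
    all_goals rw [Function.update_of_ne hi.ne, h v hv]
  exact hl.imp wall wall

theorem sum_coboundary_eq_zero (hω : IsRelativeCochain N k ω) :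
    ((boxSimplices N k).map (coboundary ω)).sum = 0 := by
  induction k generalizing ω with
  | zero =>
    simp only [boxSimplices, coboundary, facets, List.map_cons, List.map_nil, List.sum_cons,
      List.sum_nil, hω.1, add_zero]
  | succ k ih =>
    have hbottom : ((boxSimplices N k).map ω).sum = 0 :=
      List.sum_eq_zero <| List.forall_mem_map.2 fun l hl => hω.2 k k.lt_succ_self l <|
        .inl fun _ hv => apply_eq_zero_of_mem_boxSimplices hl hv le_rfl
    have htop (l : List (ℕ → ℤ)) : ω (l.map (Function.update · k (N : ℤ))) = 0 :=
      hω.2 k k.lt_succ_self _ <| .inr <| List.forall_mem_map.2 fun v _ => Function.update_self k _ v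
    simp only [sum_boxSimplices_succ_coboundary, hbottom, htop,
      ih (hω.of_succ.sum_prismSimplices_update _ _), List.map_const', List.sum_replicate, smul_zero,
      add_zero]

theorem sum_coboundary_succ (hω : IsRelativeCochain N k ω)
    (hN : ∀ l : List (ℕ → ℤ), (∀ v ∈ l, v k = N) → ω l = 0) :
    ((boxSimplices N (k + 1)).map (coboundary ω)).sum = ((boxSimplices N k).map ω).sum := by
  have htop (l : List (ℕ → ℤ)) : ω (l.map (Function.update · k (N : ℤ))) = 0 :=
    hN _ <| List.forall_mem_map.2 fun v _ => Function.update_self k _ v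
  simp only [sum_boxSimplices_succ_coboundary, htop,
    (hω.sum_prismSimplices_update _ _).sum_coboundary_eq_zero, List.map_const', List.sum_replicate,
    smul_zero, add_zero]

end IsRelativeCochain

end Box

section Sperner

/-- The mod-2 cochain that counts the simplices with vertices `0, …, k - 1`, in any order. The
vertices are meant to be the labels, in a Sperner labelling, of the vertices of another simplex. -/
def rainbow (k : ℕ) (l : List ℕ) : ZMod 2 :=
  if (l : Multiset ℕ) = Multiset.range k then 1 else 0

theorem rainbow_eq_zero_of_notMem {k i : ℕ} {l : List ℕ} (hi : i < k) (hl : i ∉ l) :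
    rainbow k l = 0 :=
  if_neg fun h : (l : Multiset ℕ) = _ => hl <| Multiset.mem_coe.1 <| h ▸ Multiset.mem_range.2 hi

-- The simplex `b, 0, …, k - 1` has one facet `0, …, k - 1` if `b = k`, and two if `b < k`.
theorem coboundary_rainbow {k : ℕ} {l : List ℕ} (hl : ∀ a ∈ l, a ≤ k) :
    coboundary (rainbow k) l = rainbow (k + 1) l := by
  let s : Multiset ℕ := l
  have hsum : coboundary (rainbow k) l =
      (s.map fun a => if s.erase a = Multiset.range k then (1 : ZMod 2) else 0).sum :=
    coboundary_comp_coe (fun s => if s = Multiset.range k then 1 else 0) l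
  rw [hsum, rainbow, Multiset.range_succ]
  by_cases h : ∃ b, s = b ::ₘ Multiset.range k
  · obtain ⟨b, hb⟩ := h
    have hbk : b ≤ k := by
      have hmem : b ∈ s := hb ▸ Multiset.mem_cons_self b _
      exact hl b hmem
    have erase_eq_iff {a} (ha : a ∈ s) : s.erase a = Multiset.range k ↔ a = b := by
      rw [← Multiset.cons_inj_right a, Multiset.cons_erase ha, hb, Multiset.cons_inj_left, eq_comm]
    calc (s.map fun a => if s.erase a = Multiset.range k then (1 : ZMod 2) else 0).sum
        = (s.map fun a => if a = b then 1 else 0).sum := by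
          exact congrArg _ <| Multiset.map_congr rfl fun a ha => by simp only [erase_eq_iff ha]
      _ = s.count b := by
          simpa [s] using List.sum_map_ite_eq l (fun _ => (1 : ZMod 2)) (fun _ => 0) b
      _ = 1 + if b < k then 1 else 0 := by
          rw [hb, Multiset.count_cons_self, Multiset.count_eq_of_nodup (Multiset.nodup_range k),
            Nat.cast_add_one, add_comm, Nat.cast_ite, Nat.cast_one, Nat.cast_zero]
          simp only [Multiset.mem_range]
      _ = if b = k then 1 else 0 := by
          obtain rfl | hbk := hbk.eq_or_lt
          · simp
          · simpa [hbk, hbk.ne] using CharTwo.add_self_eq_zero (1 : ZMod 2)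
      _ = if s = k ::ₘ Multiset.range k then 1 else 0 := by
          simp only [hb, Multiset.cons_inj_left]
  · rw [if_neg fun hs => h ⟨k, hs⟩]
    refine Multiset.sum_eq_zero <| Multiset.forall_mem_map_iff.2 fun a ha =>
      if_neg fun he => h ⟨a, ?_⟩
    rw [← he, Multiset.cons_erase ha]

theorem sum_boxSimplices_rainbow {N n : ℕ} {lab : (ℕ → ℤ) → ℕ}
    (hzero : ∀ (v : ℕ → ℤ) i, v i = 0 → lab v ≤ i)
    (hN : ∀ (v : ℕ → ℤ), ∀ i < n, v i = N → lab v ≠ i) :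
    ((boxSimplices N n).map fun l => rainbow (n + 1) (l.map lab)).sum = 1 := by
  induction n with
  | zero =>
    have hlab : lab 0 = 0 := Nat.le_zero.1 (hzero 0 0 rfl)
    simp only [boxSimplices, List.map_cons, List.map_nil, hlab, List.sum_singleton]
    rfl
  | succ k ih =>
    let ω (l : List (ℕ → ℤ)) : ZMod 2 := rainbow (k + 1) (l.map lab)
    have hω {i} (hi : i ≤ k) {l : List (ℕ → ℤ)} (hl : ∀ v ∈ l, lab v ≠ i) : ω l = 0 :=
      rainbow_eq_zero_of_notMem (Nat.lt_succ_of_le hi) <| by simpa using hl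
    have hrel : IsRelativeCochain N k ω := by
      refine ⟨hω le_rfl <| List.forall_mem_nil _, fun i hi l hl => ?_⟩
      obtain hl | hl := hl
      · exact hω le_rfl fun v hv => ((hzero v i (hl v hv)).trans_lt hi).ne
      · exact hω hi.le fun v hv => hN v i (hi.trans k.lt_succ_self) (hl v hv)
    calc ((boxSimplices N (k + 1)).map fun l => rainbow (k + 2) (l.map lab)).sum
        = ((boxSimplices N (k + 1)).map (coboundary ω)).sum := by
          refine congrArg List.sum <| List.map_congr_left fun l hl => ?_
          rw [← coboundary_map, coboundary_rainbow]
          exact List.forall_mem_map.2 fun v hv =>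
            hzero v _ (apply_eq_zero_of_mem_boxSimplices hl hv le_rfl)
      _ = ((boxSimplices N k).map ω).sum := hrel.sum_coboundary_succ fun l hl =>
          hω le_rfl fun v hv => hN v k k.lt_succ_self (hl v hv)
      _ = 1 := ih fun v i hi => hN v i (hi.trans k.lt_succ_self)

theorem exists_rainbow_simplex {n N : ℕ} {lab : (Fin n → ℤ) → ℕ} (hle : ∀ v, lab v ≤ n)
    (hzero : ∀ (v : Fin n → ℤ) i, v i = 0 → lab v ≤ i)
    (hN : ∀ (v : Fin n → ℤ) i, v i = N → lab v ≠ i) :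
    ∃ v : Fin (n + 1) → Fin n → ℤ, (∀ j, lab (v j) = j) ∧ ∀ j j' i, |v j i - v j' i| ≤ 1 := by
  let restrict (u : ℕ → ℤ) (i : Fin n) : ℤ := u i
  have hsum :
      ((boxSimplices N n).map fun l => rainbow (n + 1) (l.map (lab ∘ restrict))).sum = 1 := by
    refine sum_boxSimplices_rainbow (fun u i hu => ?_) fun u i hi hu => hN (restrict u) ⟨i, hi⟩ hu
    obtain hi | hi := lt_or_ge i n
    · exact hzero (restrict u) ⟨i, hi⟩ hu
    · exact (hle _).trans hi
  obtain ⟨l, hl, hlab⟩ : ∃ l ∈ boxSimplices N n,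
      (l.map (lab ∘ restrict) : Multiset ℕ) = Multiset.range (n + 1) := by
    by_contra! h
    refine zero_ne_one' (ZMod 2) <| Eq.trans ?_ hsum
    exact (List.sum_eq_zero <| List.forall_mem_map.2 fun l hl => if_neg (h l hl)).symm
  have hmem (j : Fin (n + 1)) : ∃ u ∈ l, lab (restrict u) = j :=
    List.mem_map.1 <| Multiset.mem_coe.1 <| hlab ▸ Multiset.mem_range.2 j.2
  choose u hul hu using hmem
  have hclose : ∀ v ∈ l, ∀ w ∈ l, ∀ i, |v i - w i| ≤ 1 := by
    have : Std.Symm fun v w : ℕ → ℤ => ∀ i, |v i - w i| ≤ 1 :=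
      ⟨fun v w h i => abs_sub_comm (v i) (w i) ▸ h i⟩
    refine fun v hv w hw => List.Pairwise.forall_of_forall (R := fun v w => ∀ i, |v i - w i| ≤ 1)
      (fun v _ i => by simp) ((pairwise_of_mem_boxSimplices hl).imp fun h i => ?_) hv hw
    have := h i
    rw [abs_le]
    lia
  exact ⟨fun j => restrict (u j), hu, fun j j' i => hclose _ (hul j) _ (hul j') i⟩

end Sperner

section Covering

theorem exists_injective_comp_of_abs_sub_lt {β : Type*} {n K : ℕ} {c : (Fin n → ℤ) → β}
    (hc : ∀ x y, c x = c y → ∀ i, |x i - y i| < K) :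
    ∃ v : Fin (n + 1) → Fin n → ℤ,
      (∀ j j' i, |v j i - v j' i| ≤ 1) ∧ Function.Injective (c ∘ v) := by
  let reached (b : β) : Set ℕ := {i | ∀ h : i < n, ∃ y, c y = b ∧ y ⟨i, h⟩ ≤ 0}
  have n_mem_reached (b) : n ∈ reached b := fun h => (lt_irrefl n h).elim
  let lab (x : Fin n → ℤ) : ℕ := sInf (reached (c x))
  have hle (x) : lab x ≤ n := Nat.sInf_le (n_mem_reached _)
  have hzero (x : Fin n → ℤ) (i) (hx : x i = 0) : lab x ≤ i :=
    Nat.sInf_le fun _ => ⟨x, rfl, hx.le⟩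
  have hK (x : Fin n → ℤ) (i) (hx : x i = K) : lab x ≠ i := by
    intro hi
    have hmem : lab x ∈ reached (c x) := Nat.sInf_mem ⟨n, n_mem_reached _⟩
    rw [hi] at hmem
    obtain ⟨y, hy, hyi⟩ := hmem i.2
    have hxy := hc x y hy.symm i
    rw [hx, abs_lt] at hxy
    exact (sub_lt_self_iff _).1 hxy.2 |>.not_ge hyi
  obtain ⟨v, hlab, hclose⟩ := exists_rainbow_simplex hle hzero hK
  refine ⟨v, hclose, fun j j' hjj' => Fin.ext ?_⟩
  rw [← hlab j, ← hlab j']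
  exact congrArg (fun b => sInf (reached b)) hjj'

theorem lt_card_of_encard_cluster_le {α : Type*} [Fintype α] {n K : ℕ} (f : (Fin n → ℤ) → α)
    (hK : ∀ x, (cluster (kingGraph n) f x).encard ≤ K) : n < Fintype.card α := by
  obtain ⟨v, hclose, hinj⟩ := exists_injective_comp_of_abs_sub_lt (c := cluster (kingGraph n) f)
    (K := K) fun x y hxy i => by
      have hy : y ∈ cluster (kingGraph n) f x := hxy ▸ mem_cluster_self _ f y
      obtain ⟨p, hp⟩ := exists_walk_length_lt_of_mem_cluster (hK x) hy
      exact (abs_sub_le_length_of_kingGraph_walk p i).trans_lt (by exact_mod_cast hp)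
  have hf : Function.Injective (f ∘ v) := by
    intro j j' hjj'
    refine hinj ?_
    by_cases hne : v j = v j'
    · exact congrArg (cluster (kingGraph n) f) hne
    · exact cluster_eq_of_adj (kingGraph_adj_iff.2 ⟨hne, hclose j j'⟩) hjj'
  simpa using Fintype.card_le_of_injective _ hf

end Covering

theorem mainTheorem3 (n m : ℕ) (hn : 1 ≤ n) (hm : 1 ≤ m) :
    clusteredChromaticNumber (kingGraph n) m = ((n + 1 : ℕ) : ℕ∞) ∧
      optimalClusterSize (kingGraph n) m ≤ ((n.factorial * m ^ n : ℕ) : ℕ∞) := by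
  obtain ⟨f, hf⟩ := exists_isClusteredColoringWith_kingGraph n hm
  have hpos : 0 < n.factorial * m ^ n := by positivity
  have hchi : clusteredChromaticNumber (kingGraph n) m = ((n + 1 : ℕ) : ℕ∞) := by
    refine le_antisymm (iInf₂_le (n + 1) ⟨by lia, f, _, hpos, hf⟩) (le_iInf₂ fun k hk => ?_)
    obtain ⟨-, g, K, -, hg⟩ := hk
    have hlt := lt_card_of_encard_cluster_le g fun x => (hg (g x)).1 _
    rw [Fintype.card_fin] at hlt
    exact_mod_cast hlt
  exact ⟨hchi, iInf₂_le (n.factorial * m ^ n) ⟨hpos, n + 1, hchi.symm, f, hf⟩⟩
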